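/- Let $n\ge 1$ and let $\delta=(n,\delta^+,\delta^-)$ be an orientation of $[n]$, that is, $\delta^+,\delta^-\subseteq[n]$ are arbitrary subsets. A $\delta$-permutree is a directed tree on the vertex set $[n]$ in which each vertex $v\notin\delta^+$ has one (possibly empty) parent (outgoing neighbor), each $v\in\delta^+$ has a left and a right parent (each possibly empty), such that all labels in the left ancestor subtree of $v$ are smaller than $v$ and all labels in its right ancestor subtree are larger than $v$, and symmetrically for children (incoming neighbors), descendant subtrees and $\delta^-$. Its transitive closure $\lhd_T$ is the poset with $i\lhd_T j$ if and only if there is an oriented (possibly trivial) path from $i$ to $j$ in $T$. Write $T\le T'$ if there are linear extensions $\sigma$ of $\lhd_T$ and $\sigma'$ of $\lhd_{T'}$ with $\sigma\le\sigma'$ in the weak order (inclusion of inversion sets of values), and for $T\le T'$ let $\lhd_{[T,T']}=\bigcap_{T\le S\le T'}\lhd_S$. Let $\mathrm{PEP}(\delta)$ be the set of all $\lhd_T$, and $\mathrm{PIP}(\delta)$ the set of all $\lhd_{[T,T']}$ with $T\le T'$, for $\delta$-permutrees $T,T'$. For a poset $\lhd$ on $[n]$ (a reflexive, antisymmetric,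 transitive relation; $u\rhd v$ means $v\lhd u$), a $\delta$-snake joining $x_0$ to $x_{k+1}$ ($k\ge 0$) is a sequence $x_0<x_1<\dots<x_{k+1}$ in $[n]$ such that either $x_0\lhd x_1\rhd x_2\lhd x_3\rhd\cdots$ with $x_i\in\delta^-$ for odd $i\in[k]$ and $x_i\in\delta^+$ for even $i\in[k]$, or $x_0\rhd x_1\lhd x_2\rhd x_3\lhd\cdots$ with $x_i\in\delta^+$ for odd $i\in[k]$ and $x_i\in\delta^-$ for even $i\in[k]$. Then for every poset $\lhd$ on $[n]$ the following are equivalent: 1. $\lhd\in\mathrm{PEP}(\delta)$; 2. $\lhd\in\mathrm{PIP}(\delta)$, and for all $a<c$ in $[n]$ there is a $\delta$-snake in $\lhd$ joining $a$ to $c$; 3. for all $a<c$ in $[n]$ there is a $\delta$-snake in $\lhd$ joining $a$ to $c$, and for all $a<b<c$ in $[n]$: $a\lhd c$ implies $a\lhd b$ or $b\lhd c$; $a\rhd c$ implies $a\rhd b$ or $b\rhd c$; if $b\in\delta^+$, then $a\lhd c$ implies $a\lhd b$, and $a\rhd c$ implies $b\rhd c$; if $b\in\delta^-$, then $a\lhd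 c$ implies $b\lhd c$, and $a\rhd c$ implies $a\rhd b$. -/

import Mathlib

/-- An orientation of `[n]` (the set `[n]` with its usual order is modelled by `Fin n`):
two arbitrary subsets of `[n]`, which may be empty, may intersect, and so on. -/
structure PermutreeOrientation (n : ℕ) where
  /-- the values with two parents -/
  plus : Set (Fin n)
  /-- the values with two children -/
  minus : Set (Fin n)

/-- For a vertex `v` of a graph `G` and a neighbor `u` of `v`, the set of vertices of the subtree of
`G` attached to `v` through `u`: the vertices joined to `u` by a walk that avoids `v`. -/
def subtreeAt {n : ℕ} (G : SimpleGraph (Fin n)) (v u : Fin n) : Set (Fin n) :=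
  {w | ∃ p : G.Walk u w, v ∉ p.support}

/-- A `δ`-permutree. The vertices are identified with their labels in `[n]`, and `Edge u v` is an
edge oriented from `u` to `v`, so that `v` is a parent of `u` and `u` is a child of `v`.

As usual for permutrees, a parent or a child of a vertex may be empty (a binary tree, for
instance, is a permutree all of whose vertices have two, possibly empty, children).
So a vertex outside `δ.plus` has one, possibly empty, parent, and a vertex in `δ.plus` has a left
and a right parent, both possibly empty; similarly for `δ.minus` and the children. -/
structure Permutree {n : ℕ} (δ : PermutreeOrientation n) where
  /-- the oriented edges, from child to parent -/
  Edge : Fin n → Fin n → Prop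
  asymm : ∀ u v, Edge u v → ¬ Edge v u
  isTree : (SimpleGraph.fromRel Edge).IsTree
  /-- a vertex not in `δ.plus` has a single parent -/
  one_parent : ∀ v, v ∉ δ.plus → ∀ u w, Edge v u → Edge v w → u = w
  /-- a vertex in `δ.plus` has a single left parent and a single right parent -/
  two_parents : ∀ v, v ∈ δ.plus → ∀ u w, Edge v u → Edge v w → (u < v ↔ w < v) → u = w
  /-- the left ancestor subtree has smaller labels, the right ancestor subtree larger ones -/
  ancestor_labels : ∀ v, v ∈ δ.plus → ∀ u, Edge v u →
    (∀ w ∈ subtreeAt (SimpleGraph.fromRel Edge) v u, w < v) ∨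
    (∀ w ∈ subtreeAt (SimpleGraph.fromRel Edge) v u, v < w)
  /-- a vertex not in `δ.minus` has a single child -/
  one_child : ∀ v, v ∉ δ.minus → ∀ u w, Edge u v → Edge w v → u = w
  /-- a vertex in `δ.minus` has a single left child and a single right child -/
  two_children : ∀ v, v ∈ δ.minus → ∀ u w, Edge u v → Edge w v → (u < v ↔ w < v) → u = w
  /-- the left descendant subtree has smaller labels, the right descendant subtree larger ones -/
  descendant_labels : ∀ v, v ∈ δ.minus → ∀ u, Edge u v →
    (∀ w ∈ subtreeAt (SimpleGraph.fromRel Edge) v u, w < v) ∨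
    (∀ w ∈ subtreeAt (SimpleGraph.fromRel Edge) v u, v < w)

/-- The (reflexive) transitive closure of a permutree: `i` is below `j` if and only if there is
an oriented path from `i` to `j`. -/
def Permutree.rel {n : ℕ} {δ : PermutreeOrientation n} (T : Permutree δ) :
    Fin n → Fin n → Prop :=
  Relation.ReflTransGen T.Edge

/-- The permutree element posets: transitive closures of `δ`-permutrees. -/
def PEP {n : ℕ} (δ : PermutreeOrientation n) : Set (Fin n → Fin n → Prop) :=
  {R | ∃ T : Permutree δ, R = T.rel}

/-- The inversions of a permutation `σ(1) ⋯ σ(n)`: the pairs of values `(b, a)` with `a ≤ b` such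
that `b` is not after `a`. -/
def permInversions {n : ℕ} (σ : Equiv.Perm (Fin n)) : Set (Fin n × Fin n) :=
  {x | x.2 ≤ x.1 ∧ σ.symm x.1 ≤ σ.symm x.2}

/-- The weak order on permutations: inclusion of inversions. -/
def permWeakLE {n : ℕ} (σ τ : Equiv.Perm (Fin n)) : Prop :=
  permInversions σ ⊆ permInversions τ

/-- `σ(1) ⋯ σ(n)` is a linear extension of the relation `R`. -/
def IsLinearExtension {n : ℕ} (R : Fin n → Fin n → Prop) (σ : Equiv.Perm (Fin n)) : Prop :=
  ∀ u v, R u v → σ.symm u ≤ σ.symm v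

/-- The order of the permutree lattice: `T ≤ T'` if some linear extension of `T` is below some
linear extension of `T'` in the weak order. -/
def Permutree.latticeLE {n : ℕ} {δ : PermutreeOrientation n} (T T' : Permutree δ) : Prop :=
  ∃ σ τ : Equiv.Perm (Fin n),
    IsLinearExtension T.rel σ ∧ IsLinearExtension T'.rel τ ∧ permWeakLE σ τ

/-- The poset of the permutree lattice interval `[T, T']`: the intersection of the posets of all
the permutrees `S` with `T ≤ S ≤ T'`. -/
def permutreeIntervalRel {n : ℕ} {δ : PermutreeOrientation n} (T T' : Permutree δ) :
    Fin n → Fin n → Prop :=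
  fun i j => ∀ S : Permutree δ, T.latticeLE S → S.latticeLE T' → S.rel i j

/-- The permutree interval posets. -/
def PIP {n : ℕ} (δ : PermutreeOrientation n) : Set (Fin n → Fin n → Prop) :=
  {R | ∃ T T' : Permutree δ, T.latticeLE T' ∧ R = permutreeIntervalRel T T'}

/-- The conditions that describe weak order interval posets. -/
def WOIPConditions {n : ℕ} (R : Fin n → Fin n → Prop) : Prop :=
  ∀ a b c : Fin n, a < b → b < c →
    (R a c → R a b ∨ R b c) ∧ (R c a → R b a ∨ R c b)

/-- The four orientation conditions. -/
def OrientationConditions {n : ℕ} (δ : PermutreeOrientation n)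
    (R : Fin n → Fin n → Prop) : Prop :=
  ∀ a b c : Fin n, a < b → b < c →
    (b ∈ δ.plus → R a c → R a b) ∧
    (b ∈ δ.minus → R a c → R b c) ∧
    (b ∈ δ.plus → R c a → R c b) ∧
    (b ∈ δ.minus → R c a → R b a)

/-- `x 0 < x 1 < ⋯ < x (k + 1)` is a `δ`-snake of length `k` in the relation `R`. -/
def IsSnake {n : ℕ} (δ : PermutreeOrientation n) (R : Fin n → Fin n → Prop) (k : ℕ)
    (x : Fin (k + 2) → Fin n) : Prop :=
  StrictMono x ∧
  (((∀ i : Fin (k + 1), (Even (i : ℕ) → R (x i.castSucc) (x i.succ)) ∧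
        (Odd (i : ℕ) → R (x i.succ) (x i.castSucc))) ∧
      (∀ i : Fin (k + 2), 1 ≤ (i : ℕ) → (i : ℕ) ≤ k →
        (Odd (i : ℕ) → x i ∈ δ.minus) ∧ (Even (i : ℕ) → x i ∈ δ.plus))) ∨
    ((∀ i : Fin (k + 1), (Even (i : ℕ) → R (x i.succ) (x i.castSucc)) ∧
        (Odd (i : ℕ) → R (x i.castSucc) (x i.succ))) ∧
      (∀ i : Fin (k + 2), 1 ≤ (i : ℕ) → (i : ℕ) ≤ k →
        (Odd (i : ℕ) → x i ∈ δ.plus) ∧ (Even (i : ℕ) → x i ∈ δ.minus))))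

/-- There is a `δ`-snake in `R` between any two (distinct) values of `[n]`. -/
def HasAllSnakes {n : ℕ} (δ : PermutreeOrientation n) (R : Fin n → Fin n → Prop) : Prop :=
  ∀ a c : Fin n, a < c →
    ∃ (k : ℕ) (x : Fin (k + 2) → Fin n),
      IsSnake δ R k x ∧ x 0 = a ∧ x (Fin.last (k + 1)) = c

/-! The permutree of a poset is its Hasse diagram, and snakes matter only through their first step
(`UpStep` and its reversal). Under the interval and orientation conditions, the direction, up or
down, of the first step from `v` towards `w` is unique and constant while `w` runs over a component
of the diagram minus `v`; when it is up and `v ∈ P`, the side of `v` on which `w` lies is constant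
too (`upStep_of_walk`). Since `v` has at most one parent, or one per side (`parent_unique`),
distinct neighbors of `v` lie in distinct components. This gives acyclicity and the label
conditions; connectedness is an induction on the distance between labels.

Conversely, the tree path from `b` to `c` in a permutree is oriented or has a first turn, whose
label lies between `b` and `c`. This yields snakes (`upStep_of_path`) and the conditions
(`betweenConditions`). An interval poset takes its increasing relations from the upper permutree and
its decreasing ones from the lower (`rel_of_latticeLE`), so it inherits the conditions. -/

/-- `b` lies strictly between `a` and `c`, in either direction. -/
def Between {α : Type*} [LinearOrder α] (a b c : α) : Prop :=
  (a < b ∧ b < c) ∨ (c < b ∧ b < a)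

/-- The first turning point (or the end) `x` of a snake from `u` to `w` starting upwards. -/
def UpStep {α : Type*} [LinearOrder α] (M : Set α) (R : α → α → Prop) (u w : α) : Prop :=
  ∃ x, R u x ∧ x ≠ u ∧ (x = w ∨ (Between u x w ∧ x ∈ M))

/-- The cover relation of `R`. -/
def Covers {α : Type*} (R : α → α → Prop) (a b : α) : Prop :=
  R a b ∧ a ≠ b ∧ ∀ x, R a x → R x b → x = a ∨ x = b

/-- The interval and orientation conditions, in a form that is symmetric under reversal of the
order of the labels. -/
def BetweenConditions {α : Type*} [LinearOrder α] (P M : Set α) (R : α → α → Prop) : Prop :=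
  ∀ a b c, Between a b c → R a c → (b ∈ P → R a b) ∧ (b ∈ M → R b c) ∧ (R a b ∨ R b c)

/-- Posets that satisfy the interval and orientation conditions, and in which a snake can be started
between any two distinct elements. -/
structure SnakePoset {α : Type*} [LinearOrder α] (P M : Set α) (R : α → α → Prop) : Prop where
  refl : ∀ a, R a a
  antisymm : ∀ a b, R a b → R b a → a = b
  trans : ∀ a b c, R a b → R b c → R a c
  between : BetweenConditions P M R
  step : ∀ u w, u ≠ w → UpStep M R u w ∨ UpStep P (fun a b => R b a) u w

/-! ### Hasse diagrams of finite posets -/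

section
variable {β : Type*} {R : β → β → Prop}

theorem covers_flip {a b : β} : Covers (fun x y => R y x) a b ↔ Covers R b a := by
  unfold Covers; grind

theorem fromRel_covers_adj {a b : β} :
    (SimpleGraph.fromRel (Covers R)).Adj a b ↔ Covers R a b ∨ Covers R b a := by
  rw [SimpleGraph.fromRel_adj]
  unfold Covers; grind

theorem fromRel_flip (E : β → β → Prop) :
    SimpleGraph.fromRel (fun a b => E b a) = SimpleGraph.fromRel E := by
  ext a b
  simp only [SimpleGraph.fromRel_adj]
  tauto

theorem fromRel_covers_flip :
    SimpleGraph.fromRel (Covers fun a b => R b a) = SimpleGraph.fromRel (Covers R) := by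
  ext a b
  rw [fromRel_covers_adj, fromRel_covers_adj, or_comm]
  exact or_congr covers_flip covers_flip

theorem reflTransGen_covers [Finite β] (hrefl : ∀ a, R a a)
    (hantisymm : ∀ a b, R a b → R b a → a = b) (htrans : ∀ a b c, R a b → R b c → R a c) :
    Relation.ReflTransGen (Covers R) = R := by
  classical
  let _ : Fintype β := Fintype.ofFinite β
  let _ : PartialOrder β :=
    { le := R, le_refl := hrefl, le_trans := htrans, le_antisymm := hantisymm }
  let _ : LocallyFiniteOrder β := Fintype.toLocallyFiniteOrder
  have hcov : ∀ a b : β, a ⋖ b → Covers R a b := fun a b hab =>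
    ⟨hab.le, hab.ne, fun x h1 h2 => hab.eq_or_eq h1 h2⟩
  funext a b
  apply propext
  constructor
  · intro h
    induction h with
    | refl => exact hrefl _
    | tail _ h ih => exact htrans _ _ _ ih h.1
  · intro h
    exact Relation.ReflTransGen.mono hcov _ _ (le_iff_reflTransGen_covBy.1 (show a ≤ b from h))

theorem reachable_of_rel [Finite β] (hrefl : ∀ a, R a a)
    (hantisymm : ∀ a b, R a b → R b a → a = b) (htrans : ∀ a b c, R a b → R b c → R a c)
    {a b : β} (hab : R a b) : (SimpleGraph.fromRel (Covers R)).Reachable a b := by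
  rw [← reflTransGen_covers hrefl hantisymm htrans] at hab
  induction hab with
  | refl => exact .refl _
  | tail _ h ih => exact ih.trans (SimpleGraph.Adj.reachable (fromRel_covers_adj.2 (.inl h)))

end

/-! ### Local structure of the Hasse diagram of a snake poset -/

section
variable {α : Type*} [LinearOrder α] {P M : Set α} {R : α → α → Prop}

theorem Between.symm {a b c : α} (h : Between a b c) : Between c b a := Or.symm h

theorem BetweenConditions.flip (h : BetweenConditions P M R) :
    BetweenConditions M P (fun a b => R b a) := by
  intro a b c hb hR
  have := h c b a hb.symm hR
  tauto

/-- Duality: every fact about parents gives one about children. Reversal of labels needs no such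
lemma, as `Between` is symmetric. -/
theorem SnakePoset.flip (h : SnakePoset P M R) : SnakePoset M P (fun a b => R b a) where
  refl := h.refl
  antisymm a b h1 h2 := h.antisymm a b h2 h1
  trans a b c h1 h2 := h.trans c b a h2 h1
  between := h.between.flip
  step u w huw := (h.step u w huw).symm

namespace SnakePoset

theorem upStep_ne {v w : α} (hu : UpStep M R v w) : v ≠ w := by
  unfold UpStep Between at hu; grind

/-- If the two targets differ, the one nearer to `v` is a turning point, and its orientation
condition, applied to the longer relation, contradicts antisymmetry. -/
theorem not_upStep_downStep (h : SnakePoset P M R) {v w : α} (hu : UpStep M R v w)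
    (hd : UpStep P (fun a b => R b a) v w) : False := by
  obtain ⟨x, h1, h2, h3⟩ := hu
  obtain ⟨y, h4, h5, h6⟩ := hd
  have k1 := h.between v y x
  have k2 := h.between y x v
  have k3 := h.antisymm v x
  have k4 := h.antisymm v y
  unfold Between at *
  grind

/-- Either a turning point contradicts antisymmetry, or `v` gets inserted strictly inside the cover
relation joining `x` and `y`. -/
theorem not_upStep_downStep_of_between (h : SnakePoset P M R) {v x y : α} (hb : Between v x y)
    (hxy : Covers R x y ∨ Covers R y x) (hu : UpStep M R v x)
    (hd : UpStep P (fun a b => R b a) v y) : False := by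
  obtain ⟨x', h1, h2, h3⟩ := hu
  obtain ⟨y', h4, h5, h6⟩ := hd
  have hvx : v ≠ x := by unfold Between at hb; grind
  have hvy : v ≠ y := by unfold Between at hb; grind
  by_cases e1 : Between v y' x'
  · have k1 := h.between v y' x' e1 h1
    have k3 := h.antisymm v y'
    unfold Between at *
    grind
  by_cases e2 : y' = x'
  · have k3 := h.antisymm v y'
    grind
  have e3 : Between v x' y' := by unfold Between at *; grind
  rcases h3 with rfl | ⟨h3, h3'⟩
  · rcases h6 with rfl | ⟨h6, h6'⟩
    · rcases hxy with ⟨_, hne, hc⟩ | ⟨_, hne, hc⟩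
      · have := h.antisymm x' y' ‹_› (h.trans _ _ _ h4 h1)
        exact hne this
      · have := hc v h4 h1
        grind
    · have hb' : Between x' y' y := by unfold Between at *; grind
      have hyx : R y' x' := h.trans _ _ _ h4 h1
      rcases hxy with ⟨hR, hne, hc⟩ | ⟨hR, hne, hc⟩
      · have k1 := (h.between _ _ _ hb' hR).1 h6'
        exact e2 (h.antisymm _ _ hyx k1)
      · have k1 := (h.between _ _ _ hb'.symm hR).1 h6'
        have := hc v (h.trans _ _ _ k1 h4) h1
        grind
  · have k1 := (h.between _ _ _ e3.symm h4).2.1 h3'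
    exact h2 (h.antisymm _ _ k1 h1)

/-- The target `t` of the step satisfies `R t y`, so `x`, `v`, `t`, `y` is a chain and `v` breaks
the cover. -/
theorem not_upStep_of_covers_around (h : SnakePoset P M R) {v x y z : α} (hb : Between x v y)
    (hxy : Covers R x y) (hv : R x v) (hz : z = x ∨ z = y) (hu : UpStep M R v z) : False := by
  obtain ⟨hR, hne, hc⟩ := hxy
  obtain ⟨t, h1, h2, h3⟩ := hu
  have hty : R t y := by
    rcases h3 with rfl | ⟨h3, h3'⟩
    · rcases hz with rfl | rfl
      · exact hR
      · exact h.refl _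
    · refine (h.between x t y ?_ hR).2.1 h3'
      unfold Between at *; grind
  have := hc v hv (h.trans _ _ _ h1 hty)
  unfold Between at hb
  grind

theorem not_upStep_downStep_of_covers_around (h : SnakePoset P M R) {v x y z z' : α}
    (hb : Between x v y) (hxy : Covers R x y) (hz : z = x ∨ z = y) (hz' : z' = x ∨ z' = y)
    (hu : UpStep M R v z) (hd : UpStep P (fun a b => R b a) v z') : False := by
  rcases (h.between _ _ _ hb hxy.1).2.2 with k | k
  · exact h.not_upStep_of_covers_around hb hxy k hz hu
  · exact h.flip.not_upStep_of_covers_around hb.symm (covers_flip.2 hxy) k hz'.symm hd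

theorem upStep_of_adj (h : SnakePoset P M R) {v x y : α} (hvy : v ≠ y)
    (hxy : Covers R x y ∨ Covers R y x) (hu : UpStep M R v x) : UpStep M R v y := by
  refine (h.step v y hvy).resolve_right fun hd => ?_
  have hvx := upStep_ne hu
  have hne : x ≠ y := by rcases hxy with h | h <;> [exact h.2.1; exact h.2.1.symm]
  by_cases e1 : Between v x y
  · exact h.not_upStep_downStep_of_between e1 hxy hu hd
  by_cases e2 : Between v y x
  · exact h.flip.not_upStep_downStep_of_between e2
      (hxy.imp covers_flip.2 covers_flip.2) hd hu
  have e3 : Between x v y := by unfold Between at *; grind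
  rcases hxy with hxy | hxy
  · exact h.not_upStep_downStep_of_covers_around e3 hxy (.inl rfl) (.inr rfl) hu hd
  · exact h.not_upStep_downStep_of_covers_around e3.symm hxy (.inr rfl) (.inl rfl) hu hd

theorem lt_iff_lt_of_adj (h : SnakePoset P M R) {v x y : α} (hvy : v ≠ y) (hv : v ∈ P)
    (hxy : Covers R x y ∨ Covers R y x) (hu : UpStep M R v x) : x < v ↔ y < v := by
  have hvx := upStep_ne hu
  by_contra hlt
  have e3 : Between x v y := by unfold Between; grind
  rcases hxy with hxy | hxy
  · exact h.not_upStep_of_covers_around e3 hxy ((h.between _ _ _ e3 hxy.1).1 hv) (.inl rfl) hu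
  · exact h.not_upStep_of_covers_around e3.symm hxy ((h.between _ _ _ e3.symm hxy.1).1 hv)
      (.inr rfl) hu

/-- A step from `u` towards `w` lands on some `x` with either `u` below `x` below `w`, or `v` below
`x` below `u`; each breaks a cover. -/
theorem parent_aux (h : SnakePoset P M R) {v u w : α} (hu : Covers R v u) (hw : Covers R v w)
    (hb : Between v u w) : False := by
  obtain ⟨u1, u2, u3⟩ := hu
  obtain ⟨w1, w2, w3⟩ := hw
  have hne : u ≠ w := by unfold Between at hb; grind
  rcases h.step u w hne with ⟨x, x1, x2, x3⟩ | ⟨x, x1, x2, x3⟩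
  · have : R x w := by
      rcases x3 with rfl | ⟨x3, hx⟩
      · exact h.refl _
      · refine (h.between v x w ?_ w1).2.1 hx
        unfold Between at *; grind
    have := w3 u u1 (h.trans _ _ _ x1 this)
    grind
  · have : R v x := by
      rcases x3 with rfl | ⟨x3, hx⟩
      · exact w1
      · refine (h.between v x w ?_ w1).1 hx
        unfold Between at *; grind
    have := u3 x this x1
    unfold Between at *; grind

theorem parent_aux_opposite (h : SnakePoset P M R) {v u w : α} (hu : Covers R v u)
    (hw : Covers R v w) (hv : v ∉ P) (hb : Between u v w) : False := by
  obtain ⟨u1, u2, u3⟩ := hu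
  obtain ⟨w1, w2, w3⟩ := hw
  have hne : u ≠ w := by unfold Between at hb; grind
  rcases h.step u w hne with ⟨x, x1, x2, x3⟩ | ⟨x, x1, x2, x3⟩
  · rcases x3 with rfl | ⟨x3, hx⟩
    · have := w3 u u1 x1
      grind
    by_cases e : x = v
    · subst e
      exact u2 (h.antisymm _ _ u1 x1)
    by_cases e1 : Between v x u
    · exact x2 (h.antisymm _ _ ((h.between _ _ _ e1 u1).2.1 hx) x1)
    · have e2 : Between v x w := by unfold Between at *; grind
      have := w3 u u1 (h.trans _ _ _ x1 ((h.between _ _ _ e2 w1).2.1 hx))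
      grind
  · rcases x3 with rfl | ⟨x3, hx⟩
    · have := u3 x w1 x1
      grind
    -- The only use of `v ∉ P`: otherwise the snake could turn at `v` itself.
    have e : x ≠ v := by rintro rfl; exact hv hx
    have : R v x := by
      by_cases e1 : Between v x u
      · exact (h.between _ _ _ e1 u1).1 hx
      · have e2 : Between v x w := by unfold Between at *; grind
        exact (h.between _ _ _ e2 w1).1 hx
    have := u3 x this x1
    grind

theorem parent_unique (h : SnakePoset P M R) {v u w : α} (hu : Covers R v u)
    (hw : Covers R v w) (hv : v ∈ P → (u < v ↔ w < v)) : u = w := by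
  by_contra hne
  have h1 := hu.2.1
  have h2 := hw.2.1
  by_cases e1 : Between v u w
  · exact h.parent_aux hu hw e1
  by_cases e2 : Between v w u
  · exact h.parent_aux hw hu e2
  have e3 : Between u v w := by unfold Between at *; grind
  refine h.parent_aux_opposite hu hw (fun hP => ?_) e3
  have := hv hP
  unfold Between at *; grind

theorem upStep_of_covers {v u : α} (hu : Covers R v u) : UpStep M R v u :=
  ⟨u, hu.1, hu.2.1.symm, .inl rfl⟩

end SnakePoset

/-! ### Components of the diagram minus a vertex, and acyclicity -/

namespace SnakePoset

theorem upStep_of_walk (h : SnakePoset P M R) {v u w : α} (hu : UpStep M R v u)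
    (p : (SimpleGraph.fromRel (Covers R)).Walk u w) (hp : v ∉ p.support) :
    UpStep M R v w ∧ (v ∈ P → (u < v ↔ w < v)) := by
  induction p with
  | nil => exact ⟨hu, fun _ => Iff.rfl⟩
  | @cons a b c hab q ih =>
    rw [SimpleGraph.Walk.support_cons, List.mem_cons, not_or] at hp
    have hvb : v ≠ b := fun e => hp.2 (e ▸ q.start_mem_support)
    rw [fromRel_covers_adj] at hab
    have := ih (h.upStep_of_adj hvb hab hu) hp.2
    exact ⟨this.1, fun hv => (h.lt_iff_lt_of_adj hvb hv hab hu).trans (this.2 hv)⟩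

theorem neighbor_unique_of_covers (h : SnakePoset P M R) {v u w : α} (hu : Covers R v u)
    (hw : Covers R v w ∨ Covers R w v)
    (p : (SimpleGraph.fromRel (Covers R)).Walk u w) (hp : v ∉ p.support) : u = w := by
  obtain ⟨h1, h2⟩ := h.upStep_of_walk (upStep_of_covers hu) p hp
  rcases hw with hw | hw
  · exact h.parent_unique hu hw h2
  · exact (h.not_upStep_downStep h1 (upStep_of_covers (covers_flip.2 hw))).elim

theorem neighbor_unique (h : SnakePoset P M R) {v u w : α}
    (hu : (SimpleGraph.fromRel (Covers R)).Adj v u) (hw : (SimpleGraph.fromRel (Covers R)).Adj v w)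
    (p : (SimpleGraph.fromRel (Covers R)).Walk u w) (hp : v ∉ p.support) : u = w := by
  rw [fromRel_covers_adj] at hu hw
  rcases hu with hu | hu
  · exact h.neighbor_unique_of_covers hu hw p hp
  · refine h.flip.neighbor_unique_of_covers (covers_flip.2 hu)
      (hw.symm.imp covers_flip.2 covers_flip.2)
      (p.copy rfl rfl |>.mapLe (le_of_eq fromRel_covers_flip.symm)) ?_
    simpa using hp

theorem isAcyclic_covers (h : SnakePoset P M R) :
    (SimpleGraph.fromRel (Covers R)).IsAcyclic := by
  intro v c hc
  cases c with
  | nil => exact SimpleGraph.Walk.not_isCycle_nil hc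
  | @cons _ u _ hvu p =>
    rw [SimpleGraph.Walk.cons_isCycle_iff] at hc
    obtain ⟨hp, he⟩ := hc
    rw [← SimpleGraph.Walk.isPath_reverse_iff] at hp
    rw [← List.mem_reverse, ← SimpleGraph.Walk.edges_reverse] at he
    -- The cycle leaves `v` through `u` and returns through `w`; the rest avoids `v`, so `u = w` and
    -- one edge is used twice.
    generalize p.reverse = q at hp he
    cases q with
    | nil => exact hvu.ne rfl
    | @cons _ w _ hvw q =>
      rw [SimpleGraph.Walk.cons_isPath_iff] at hp
      have := h.neighbor_unique hvw hvu q hp.2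
      subst this
      simp at he

end SnakePoset

end

/-- With truncated subtraction, the sum is the distance between the labels, which a first step
reduces. -/
theorem SnakePoset.reachable_covers {n : ℕ} {P M : Set (Fin n)} {R : Fin n → Fin n → Prop}
    (h : SnakePoset P M R) (d : ℕ) :
    ∀ u w : Fin n, (u : ℕ) - w + (w - u) = d → (SimpleGraph.fromRel (Covers R)).Reachable u w := by
  induction d using Nat.strong_induction_on with
  | _ d ih =>
  intro u w hd
  by_cases e : u = w
  · subst e; exact .refl _
  have key : ∃ x, (R u x ∨ R x u) ∧ (x = w ∨ Between u x w) := by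
    rcases h.step u w e with ⟨x, x1, -, x3⟩ | ⟨x, x1, -, x3⟩
    · exact ⟨x, .inl x1, x3.imp_right And.left⟩
    · exact ⟨x, .inr x1, x3.imp_right And.left⟩
  obtain ⟨x, x1, x2⟩ := key
  have hx : (SimpleGraph.fromRel (Covers R)).Reachable u x := by
    rcases x1 with x1 | x1
    · exact reachable_of_rel h.refl h.antisymm h.trans x1
    · exact (reachable_of_rel h.refl h.antisymm h.trans x1).symm
  refine hx.trans (ih _ ?_ x w rfl)
  unfold Between at x2
  omega

theorem SnakePoset.mem_PEP {n : ℕ} (hn : 1 ≤ n) {δ : PermutreeOrientation n}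
    {R : Fin n → Fin n → Prop} (h : SnakePoset δ.plus δ.minus R) : R ∈ PEP δ := by
  -- Stated for all `P`, `M`, `R` so as to serve the reversed poset as well.
  have hlab : ∀ {P M : Set (Fin n)} {R : Fin n → Fin n → Prop} (_ : SnakePoset P M R) (v : Fin n)
      (_ : v ∈ P) (u : Fin n) (_ : Covers R v u),
      (∀ w ∈ subtreeAt (SimpleGraph.fromRel (Covers R)) v u, w < v) ∨
      (∀ w ∈ subtreeAt (SimpleGraph.fromRel (Covers R)) v u, v < w) := by
    intro P M R h v hv u hu
    rcases lt_or_gt_of_ne hu.2.1 with hlt | hlt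
    · right
      rintro w ⟨p, hp⟩
      have := h.upStep_of_walk (SnakePoset.upStep_of_covers hu) p hp
      have h2 := this.2 hv
      have h3 := SnakePoset.upStep_ne this.1
      grind
    · left
      rintro w ⟨p, hp⟩
      have := h.upStep_of_walk (SnakePoset.upStep_of_covers hu) p hp
      exact (this.2 hv).1 hlt
  refine ⟨⟨Covers R, ?_, ?_, ?_, ?_, ?_, ?_, ?_, ?_⟩,
    (reflTransGen_covers h.refl h.antisymm h.trans).symm⟩
  · intro u v h1 h2
    exact h1.2.1 (h.antisymm _ _ h1.1 h2.1)
  · have : Nonempty (Fin n) := ⟨⟨0, hn⟩⟩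
    exact ⟨⟨fun u w => h.reachable_covers _ u w rfl⟩, h.isAcyclic_covers⟩
  · intro v hv u w hu hw
    exact h.parent_unique hu hw fun k => absurd k hv
  · intro v hv u w hu hw hi
    exact h.parent_unique hu hw fun _ => hi
  · exact hlab h
  · intro v hv u w hu hw
    exact h.flip.parent_unique (covers_flip.2 hu) (covers_flip.2 hw) fun k => absurd k hv
  · intro v hv u w hu hw hi
    exact h.flip.parent_unique (covers_flip.2 hu) (covers_flip.2 hw) fun _ => hi
  · intro v hv u hu
    have := hlab h.flip v hv u (covers_flip.2 hu)
    rwa [fromRel_covers_flip] at this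

/-! ### Permutrees satisfy the conditions and have first steps -/

namespace Permutree
variable {n : ℕ} {δ : PermutreeOrientation n}

/-- The underlying undirected tree of a permutree. -/
abbrev graph (T : Permutree δ) : SimpleGraph (Fin n) := SimpleGraph.fromRel T.Edge

theorem ne_of_edge (T : Permutree δ) {u v : Fin n} (h : T.Edge u v) : u ≠ v := by
  rintro rfl
  exact T.asymm _ _ h h

theorem adj_iff (T : Permutree δ) {u v : Fin n} : T.graph.Adj u v ↔ T.Edge u v ∨ T.Edge v u := by
  rw [SimpleGraph.fromRel_adj, and_iff_right_iff_imp]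
  rintro (h | h)
  · exact T.ne_of_edge h
  · exact (T.ne_of_edge h).symm

/-- The permutree obtained by reversing all edges. -/
def reverse (T : Permutree δ) : Permutree ⟨δ.minus, δ.plus⟩ where
  Edge u v := T.Edge v u
  asymm u v h := T.asymm v u h
  isTree := by rw [fromRel_flip]; exact T.isTree
  one_parent v hv u w := T.one_child v hv u w
  two_parents v hv u w := T.two_children v hv u w
  ancestor_labels v hv u h := by rw [fromRel_flip]; exact T.descendant_labels v hv u h
  one_child v hv u w := T.one_parent v hv u w
  two_children v hv u w := T.two_parents v hv u w
  descendant_labels v hv u h := by rw [fromRel_flip]; exact T.ancestor_labels v hv u h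

theorem reverse_rel (T : Permutree δ) : T.reverse.rel = fun a b => T.rel b a := by
  funext a b
  exact propext (Relation.reflTransGen_swap (r := T.Edge))

theorem reverse_graph (T : Permutree δ) : T.reverse.graph = T.graph := fromRel_flip T.Edge

end Permutree

section
variable {n : ℕ} {G : SimpleGraph (Fin n)}

theorem mem_subtreeAt_self {v u : Fin n} (h : v ≠ u) : u ∈ subtreeAt G v u :=
  ⟨.nil, by simpa using h⟩

theorem ne_of_mem_subtreeAt {v u w : Fin n} (h : w ∈ subtreeAt G v u) : v ≠ w := by
  obtain ⟨p, hp⟩ := h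
  rintro rfl
  exact hp p.end_mem_support

theorem mem_subtreeAt_of_walk {v u a b : Fin n} (h : a ∈ subtreeAt G v u) (p : G.Walk a b)
    (hp : v ∉ p.support) : b ∈ subtreeAt G v u := by
  obtain ⟨q, hq⟩ := h
  exact ⟨q.append p, by rw [SimpleGraph.Walk.mem_support_append_iff]; tauto⟩

theorem mem_subtreeAt_of_adj {v u a b : Fin n} (h : a ∈ subtreeAt G v u) (hab : G.Adj a b)
    (hb : v ≠ b) : b ∈ subtreeAt G v u :=
  mem_subtreeAt_of_walk h hab.toWalk (by simp [ne_of_mem_subtreeAt h, hb])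

end

namespace Permutree
variable {n : ℕ} {δ : PermutreeOrientation n}

theorem between_of_children (T : Permutree δ) {x u w a c : Fin n} (hu : T.Edge u x)
    (hw : T.Edge w x) (huw : u ≠ w) (ha : a ∈ subtreeAt T.graph x u)
    (hc : c ∈ subtreeAt T.graph x w) : x ∈ δ.minus ∧ Between a x c := by
  have hx : x ∈ δ.minus := by
    by_contra hx
    exact huw (T.one_child x hx u w hu hw)
  refine ⟨hx, ?_⟩
  have h1 := T.descendant_labels x hx u hu
  have h2 := T.descendant_labels x hx w hw
  have h3 := T.two_children x hx u w hu hw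
  have hu' := mem_subtreeAt_self (G := T.graph) (T.ne_of_edge hu).symm
  have hw' := mem_subtreeAt_self (G := T.graph) (T.ne_of_edge hw).symm
  unfold Between
  rcases h1 with h1 | h1 <;> rcases h2 with h2 | h2
  · exact absurd (h3 (iff_of_true (h1 u hu') (h2 w hw'))) huw
  · exact .inl ⟨h1 a ha, h2 c hc⟩
  · exact .inr ⟨h2 c hc, h1 a ha⟩
  · exact absurd (h3 (iff_of_false (h1 u hu').asymm (h2 w hw').asymm)) huw

/-- A path that starts upwards either goes up all the way or has a first peak. -/
theorem rel_or_exists_peak (T : Permutree δ) {b d c : Fin n} (hbd : T.Edge b d)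
    (q : T.graph.Walk d c) (hq : q.IsPath) (hb : b ∉ q.support) :
    T.rel b c ∨ ∃ x ∈ q.support, ∃ u w, T.rel b x ∧ T.Edge u x ∧ T.Edge w x ∧ u ≠ w ∧
      b ∈ subtreeAt T.graph x u ∧ c ∈ subtreeAt T.graph x w := by
  induction q generalizing b with
  | nil => exact .inl (.single hbd)
  | @cons d e c hde q ih =>
    rw [SimpleGraph.Walk.cons_isPath_iff] at hq
    have hb' := hb
    rw [SimpleGraph.Walk.support_cons, List.mem_cons, not_or] at hb'
    rcases T.adj_iff.1 hde with h | h
    · rcases ih h hq.1 hq.2 with h1 | ⟨x, hx, u, w, h1, h2, h3, h4, h5, h6⟩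
      · exact .inl (.head hbd h1)
      · refine .inr ⟨x, by simp [hx], u, w, .head hbd h1, h2, h3, h4, ?_, h6⟩
        -- The new start `b` is adjacent to `d` and differs from the peak, hence lies in the same
        -- subtree.
        refine mem_subtreeAt_of_adj h5 (T.adj_iff.2 (.inr hbd)) ?_
        rintro rfl
        exact hb'.2 hx
    · refine .inr ⟨d, by simp, b, e, .single hbd, hbd, h, ?_,
        mem_subtreeAt_self (T.ne_of_edge hbd).symm, q, hq.2⟩
      rintro rfl
      exact hb'.2 q.start_mem_support

theorem upStep_of_path (T : Permutree δ) {b d c : Fin n} (hbd : T.Edge b d)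
    (q : T.graph.Walk d c) (hq : q.IsPath) (hb : b ∉ q.support) : UpStep δ.minus T.rel b c := by
  rcases T.rel_or_exists_peak hbd q hq hb with h | ⟨x, hx, u, w, h1, h2, h3, h4, h5, h6⟩
  · refine ⟨c, h, ?_, .inl rfl⟩
    rintro rfl
    exact hb q.end_mem_support
  · obtain ⟨h7, h8⟩ := T.between_of_children h2 h3 h4 h5 h6
    exact ⟨x, h1, ne_of_mem_subtreeAt h5, .inr ⟨h8, h7⟩⟩

theorem exists_path_of_ne (T : Permutree δ) {b c : Fin n} (hbc : b ≠ c) :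
    ∃ (d : Fin n) (_ : T.graph.Adj b d) (q : T.graph.Walk d c), q.IsPath ∧ b ∉ q.support := by
  obtain ⟨p, hp⟩ := (T.isTree.1.preconnected b c).exists_isPath
  cases p with
  | nil => exact absurd rfl hbc
  | cons h q =>
    rw [SimpleGraph.Walk.cons_isPath_iff] at hp
    exact ⟨_, h, q, hp⟩

theorem upStep_or_downStep (T : Permutree δ) {b c : Fin n} (hbc : b ≠ c) :
    UpStep δ.minus T.rel b c ∨ UpStep δ.plus (fun x y => T.rel y x) b c := by
  obtain ⟨d, hd, q, hq, hb⟩ := T.exists_path_of_ne hbc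
  rcases T.adj_iff.1 hd with h | h
  · exact .inl (T.upStep_of_path h q hq hb)
  · right
    rw [← T.reverse_rel]
    exact T.reverse.upStep_of_path (δ := ⟨δ.minus, δ.plus⟩) h
      (q.mapLe T.reverse_graph.ge) (by simpa using hq) (by simpa using hb)

theorem rel_trans (T : Permutree δ) {a b c : Fin n} (h : T.rel a b) (h' : T.rel b c) :
    T.rel a c := Relation.ReflTransGen.trans h h'

theorem rel_through_or_exists_walk (T : Permutree δ) {a c : Fin n} (h : T.rel a c) (x : Fin n) :
    (T.rel a x ∧ T.rel x c) ∨ ∃ p : T.graph.Walk a c, x ∉ p.support := by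
  induction h with
  | refl =>
    by_cases hx : x = a
    · subst hx; exact .inl ⟨.refl, .refl⟩
    · exact .inr ⟨.nil, by simpa using hx⟩
  | @tail b c h hbc ih =>
    rcases ih with ⟨h1, h2⟩ | ⟨p, hp⟩
    · exact .inl ⟨h1, h2.tail hbc⟩
    · by_cases hx : x = c
      · subst hx; exact .inl ⟨h.tail hbc, .refl⟩
      · refine .inr ⟨p.concat (T.adj_iff.2 (.inl hbc)), ?_⟩
        simp [SimpleGraph.Walk.support_concat, hp, hx]

/-- Here `a` and `c` lie in one ancestor subtree of `b`, so `b ∈ δ.plus` would put them on one side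
of `b`. A peak between `b` and `c` missed by the path from `a` to `c` would separate `b` from both,
hence lie on both sides of `b`. -/
theorem rel_of_between_above (T : Permutree δ) {a b c u : Fin n} (hb : Between a b c)
    (hac : T.rel a c) (hu : T.Edge b u) (p : T.graph.Walk a c) (hp : b ∉ p.support)
    (hc : c ∈ subtreeAt T.graph b u) : b ∉ δ.plus ∧ T.rel b c := by
  have ha : a ∈ subtreeAt T.graph b u := mem_subtreeAt_of_walk hc p.reverse (by simpa using hp)
  constructor
  · intro hP
    have := T.ancestor_labels b hP u hu
    unfold Between at hb
    rcases this with h | h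
    · have := h a ha; have := h c hc; omega
    · have := h a ha; have := h c hc; omega
  · obtain ⟨q, hq⟩ := hc
    rcases T.rel_or_exists_peak hu q.bypass q.bypass_isPath
      (fun h => hq (q.support_bypass_subset_support h)) with h | ⟨x, hx, u', w, h1, h2, h3, h4, h5, h6⟩
    · exact h
    · rcases T.rel_through_or_exists_walk hac x with h | ⟨r, hr⟩
      · exact T.rel_trans h1 h.2
      · have h7 := (T.between_of_children h2 h3 h4 h5 h6).2
        have h8 := (T.between_of_children h2 h3 h4 h5
          (mem_subtreeAt_of_walk h6 r.reverse (by simpa using hr))).2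
        unfold Between at *
        omega

theorem betweenConditions (T : Permutree δ) : BetweenConditions δ.plus δ.minus T.rel := by
  intro a b c hb hac
  rcases T.rel_through_or_exists_walk hac b with h | ⟨p, hp⟩
  · tauto
  have hbc : b ≠ c := by unfold Between at hb; omega
  obtain ⟨u, hu, q, -, hq⟩ := T.exists_path_of_ne hbc
  rcases T.adj_iff.1 hu with h | h
  · have := T.rel_of_between_above hb hac h p hp ⟨q, hq⟩
    tauto
  · have := T.reverse.rel_of_between_above (a := c) (c := a) (b := b) (u := u)
      hb.symm (by rw [T.reverse_rel]; exact hac) h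
      (p.reverse.mapLe T.reverse_graph.ge) (by simpa using hp)
      (by rw [T.reverse_graph]; exact mem_subtreeAt_of_walk ⟨q, hq⟩ p.reverse (by simpa using hp))
    rw [T.reverse_rel] at this
    tauto

end Permutree

/-! ### Snakes versus first steps -/

/-- An alternating chain `x 0 < x 1 < ⋯ < x (k + 1)` that starts upwards, with turning points in
`M` and `P` alternately. -/
def IsUpSnake {n : ℕ} (P M : Set (Fin n)) (R : Fin n → Fin n → Prop) (k : ℕ)
    (x : Fin (k + 2) → Fin n) : Prop :=
  (∀ i : Fin (k + 1), (Even (i : ℕ) → R (x i.castSucc) (x i.succ)) ∧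
      (Odd (i : ℕ) → R (x i.succ) (x i.castSucc))) ∧
    (∀ i : Fin (k + 2), 1 ≤ (i : ℕ) → (i : ℕ) ≤ k →
      (Odd (i : ℕ) → x i ∈ M) ∧ (Even (i : ℕ) → x i ∈ P))

section
variable {n : ℕ} {δ : PermutreeOrientation n} {P M : Set (Fin n)} {R : Fin n → Fin n → Prop}

theorem IsUpSnake.cons {k : ℕ} {x : Fin (k + 2) → Fin n} {a : Fin n}
    (h : IsUpSnake M P (fun a b => R b a) k x) (hR : R a (x 0)) (hM : x 0 ∈ M) :
    IsUpSnake P M R (k + 1) (Fin.cons a x : Fin (k + 3) → Fin n) := by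
  obtain ⟨h1, h2⟩ := h
  constructor
  · intro i
    refine Fin.cases ?_ (fun i => ?_) i
    · simpa using hR
    · have := h1 i
      rw [← Fin.succ_castSucc, Fin.cons_succ, Fin.cons_succ, Fin.val_succ, Nat.even_add_one,
        Nat.odd_add_one, Nat.not_even_iff_odd, Nat.not_odd_iff_even]
      exact this.symm
  · intro i
    refine Fin.cases (fun h => absurd h (by simp)) (fun i _ hk => ?_) i
    rw [Fin.val_succ] at hk
    rw [Fin.cons_succ, Fin.val_succ, Nat.even_add_one,
        Nat.odd_add_one, Nat.not_even_iff_odd, Nat.not_odd_iff_even]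
    by_cases hi : i = 0
    · subst hi
      exact ⟨fun _ => hM, fun h => absurd h (by simp)⟩
    · exact (h2 i (Nat.one_le_iff_ne_zero.2 fun e => hi (Fin.ext e)) (by omega)).symm

theorem IsUpSnake.replace_head {k : ℕ} {x : Fin (k + 2) → Fin n} {a : Fin n}
    (h : IsUpSnake P M R k x) (htrans : ∀ a b c, R a b → R b c → R a c) (hR : R a (x 0)) :
    IsUpSnake P M R k (Fin.cons a (Fin.tail x) : Fin (k + 2) → Fin n) := by
  obtain ⟨h1, h2⟩ := h
  constructor
  · intro i
    have := h1 i
    refine Fin.cases (fun this => ?_) (fun i this => ?_) i this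
    · simpa [Fin.tail] using htrans _ _ _ hR (this.1 (by simp))
    · simpa only [← Fin.succ_castSucc, Fin.cons_succ, Fin.tail] using this
  · intro i
    refine Fin.cases (fun h => absurd h (by simp)) (fun i h h' => ?_) i
    simpa only [Fin.cons_succ, Fin.tail] using h2 i.succ h h'

theorem strictMono_cons {k : ℕ} {x : Fin (k + 1) → Fin n} {a : Fin n} (hx : StrictMono x)
    (ha : a < x 0) : StrictMono (Fin.cons a x : Fin (k + 2) → Fin n) := by
  rw [Fin.strictMono_iff_lt_succ]
  intro i
  refine Fin.cases ?_ (fun i => ?_) i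
  · simpa using ha
  · rw [← Fin.succ_castSucc, Fin.cons_succ, Fin.cons_succ]
    exact hx Fin.castSucc_lt_succ

theorem strictMono_replace_head {k : ℕ} {x : Fin (k + 2) → Fin n} {a : Fin n} (hx : StrictMono x)
    (ha : a < x 0) : StrictMono (Fin.cons a (Fin.tail x) : Fin (k + 2) → Fin n) :=
  strictMono_cons (fun _ _ h => hx (Fin.succ_lt_succ_iff.2 h)) (ha.trans (hx (Fin.succ_pos _)))

/-- There is a snake from `a` to `c`. -/
def SnakeJoined (P M : Set (Fin n)) (R : Fin n → Fin n → Prop) (a c : Fin n) : Prop :=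
  ∃ (k : ℕ) (x : Fin (k + 2) → Fin n), (StrictMono x ∧ (IsUpSnake P M R k x ∨
      IsUpSnake M P (fun a b => R b a) k x)) ∧ x 0 = a ∧ x (Fin.last (k + 1)) = c

theorem SnakeJoined.flip {a c : Fin n} (h : SnakeJoined P M R a c) :
    SnakeJoined M P (fun a b => R b a) a c := by
  obtain ⟨k, x, ⟨h1, h2⟩, h3⟩ := h
  exact ⟨k, x, ⟨h1, h2.symm⟩, h3⟩

theorem SnakeJoined.of_rel {a c : Fin n} (hac : a < c) (h : R a c) : SnakeJoined P M R a c := by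
  refine ⟨0, ![a, c], ⟨?_, .inl ⟨fun i => ?_, fun i h1 h2 => by omega⟩⟩, rfl, rfl⟩
  · rw [Fin.strictMono_iff_lt_succ]
    intro i
    obtain rfl : i = 0 := Fin.fin_one_eq_zero i
    exact hac
  · obtain rfl : i = 0 := Fin.fin_one_eq_zero i
    simpa using h

/-- If the snake from `b` starts up, transitivity absorbs `b`; if it starts down, `b` becomes a
turning point. -/
theorem SnakeJoined.head (htrans : ∀ a b c, R a b → R b c → R a c) {a b c : Fin n} (hab : a < b)
    (h : R a b) (hb : b ∈ M) (hbc : SnakeJoined P M R b c) : SnakeJoined P M R a c := by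
  obtain ⟨k, x, ⟨h1, h2 | h2⟩, rfl, rfl⟩ := hbc
  · exact ⟨k, _, ⟨strictMono_replace_head h1 hab, .inl (h2.replace_head htrans h)⟩, rfl, rfl⟩
  · exact ⟨k + 1, _, ⟨strictMono_cons h1 hab, .inl (h2.cons h hb)⟩, rfl, rfl⟩

theorem hasAllSnakes_of_step (htrans : ∀ a b c, R a b → R b c → R a c)
    (hstep : ∀ u w, u ≠ w → UpStep δ.minus R u w ∨ UpStep δ.plus (fun a b => R b a) u w) :
    HasAllSnakes δ R := by
  have key : ∀ (d : ℕ) (a c : Fin n), a < c → (c : ℕ) - a = d →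
      SnakeJoined δ.plus δ.minus R a c := by
    intro d
    induction d using Nat.strong_induction_on with
    | _ d ih =>
    intro a c hac hd
    rcases hstep a c hac.ne with ⟨x, h1, -, rfl | ⟨h3, h4⟩⟩ | ⟨x, h1, -, rfl | ⟨h3, h4⟩⟩
    · exact .of_rel hac h1
    · have hx : a < x ∧ x < c := by unfold Between at h3; omega
      exact .head htrans hx.1 h1 h4 (ih _ (by omega) x c hx.2 rfl)
    · exact (SnakeJoined.of_rel hac h1).flip
    · have hx : a < x ∧ x < c := by unfold Between at h3; omega
      exact (SnakeJoined.head (fun a b c h h' => htrans c b a h' h) hx.1 h1 h4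
        (ih _ (by omega) x c hx.2 rfl).flip).flip
  exact fun a c hac => key _ a c hac rfl

theorem IsUpSnake.upStep_head {k : ℕ} {x : Fin (k + 2) → Fin n} (hx : StrictMono x)
    (h : IsUpSnake P M R k x) : UpStep M R (x 0) (x (Fin.last (k + 1))) := by
  refine ⟨x 1, ?_, (hx Fin.zero_lt_one).ne', ?_⟩
  · exact (h.1 0).1 (by simp)
  · rcases Nat.eq_zero_or_pos k with rfl | hk
    · exact .inl rfl
    · refine .inr ⟨.inl ⟨hx Fin.zero_lt_one, hx ?_⟩, (h.2 1 (by simp)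
        (by simpa [Nat.one_le_iff_ne_zero] using hk.ne')).1 (by simp)⟩
      rw [Fin.lt_def]
      simpa using hk

/-- The snake is read backwards; the parity of `k` decides the direction of its last step. -/
theorem IsUpSnake.step_last {k : ℕ} {x : Fin (k + 2) → Fin n} (hx : StrictMono x)
    (h : IsUpSnake P M R k x) : UpStep M R (x (Fin.last (k + 1))) (x 0) ∨
      UpStep P (fun a b => R b a) (x (Fin.last (k + 1))) (x 0) := by
  have hlt : x (Fin.last k).castSucc < x (Fin.last (k + 1)) := hx (Fin.castSucc_lt_last _)
  have h1 := h.1 (Fin.last k)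
  rw [Fin.succ_last] at h1
  have h2 := h.2 (Fin.last k).castSucc
  have h3 : (Fin.last k).castSucc = 0 ∨
      Between (x (Fin.last (k + 1))) (x (Fin.last k).castSucc) (x 0) ∧
        1 ≤ ((Fin.last k).castSucc : ℕ) := by
    rcases Nat.eq_zero_or_pos k with rfl | hk
    · exact .inl rfl
    · exact .inr ⟨.inr ⟨hx (by rw [Fin.lt_def]; simpa using hk), hlt⟩,
        by simpa [Nat.one_le_iff_ne_zero] using hk.ne'⟩
  simp only [Fin.val_castSucc, Fin.val_last, le_refl, forall_const] at h1 h2 h3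
  rcases Nat.even_or_odd k with hk | hk
  · exact .inr ⟨_, h1.1 hk, hlt.ne, h3.imp (congrArg x) fun h => ⟨h.1, (h2 h.2).2 hk⟩⟩
  · exact .inl ⟨_, h1.2 hk, hlt.ne, h3.imp (congrArg x) fun h => ⟨h.1, (h2 h.2).1 hk⟩⟩

theorem step_of_hasAllSnakes (h : HasAllSnakes δ R) (u w : Fin n) (huw : u ≠ w) :
    UpStep δ.minus R u w ∨ UpStep δ.plus (fun a b => R b a) u w := by
  rcases lt_or_gt_of_ne huw with hlt | hlt
  · obtain ⟨k, x, ⟨hx, h | h⟩, rfl, rfl⟩ := h _ _ hlt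
    · exact .inl (IsUpSnake.upStep_head (P := δ.plus) hx h)
    · exact .inr (IsUpSnake.upStep_head (P := δ.minus) (R := fun a b => R b a) hx h)
  · obtain ⟨k, x, ⟨hx, h | h⟩, rfl, rfl⟩ := h _ _ hlt
    · exact IsUpSnake.step_last hx h
    · exact (IsUpSnake.step_last (P := δ.minus) (R := fun a b => R b a) hx h).symm

theorem betweenConditions_iff :
    BetweenConditions δ.plus δ.minus R ↔ WOIPConditions R ∧ OrientationConditions δ R := by
  constructor
  · intro h
    refine ⟨fun a b c hab hbc => ?_, fun a b c hab hbc => ?_⟩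
    · have h1 := h a b c (.inl ⟨hab, hbc⟩)
      have h2 := h c b a (.inr ⟨hab, hbc⟩)
      exact ⟨fun hR => (h1 hR).2.2, fun hR => (h2 hR).2.2.symm⟩
    · have h1 := h a b c (.inl ⟨hab, hbc⟩)
      have h2 := h c b a (.inr ⟨hab, hbc⟩)
      exact ⟨fun hb hR => (h1 hR).1 hb, fun hb hR => (h1 hR).2.1 hb,
        fun hb hR => (h2 hR).1 hb, fun hb hR => (h2 hR).2.1 hb⟩
  · rintro ⟨h1, h2⟩ a b c (⟨hab, hbc⟩ | ⟨hab, hbc⟩) hR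
    · obtain ⟨k1, k2, -, -⟩ := h2 a b c hab hbc
      exact ⟨fun hb => k1 hb hR, fun hb => k2 hb hR, (h1 a b c hab hbc).1 hR⟩
    · obtain ⟨-, -, k1, k2⟩ := h2 c b a hab hbc
      exact ⟨fun hb => k1 hb hR, fun hb => k2 hb hR, ((h1 c b a hab hbc).2 hR).symm⟩

/-- A first step of `R` up to `x` leaves the shorter relation `R' x c` for induction; a step down to
`x` would give `R' a x` against `hdisj`. -/
theorem rel_of_step {R' : Fin n → Fin n → Prop} (htrans : ∀ a b c, R a b → R b c → R a c)
    (hstep : ∀ u w, u ≠ w → UpStep M R u w ∨ UpStep P (fun a b => R b a) u w)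
    (hR' : BetweenConditions P M R') (hdisj : ∀ a c, a < c → R' a c → ¬ R c a) (d : ℕ) :
    ∀ a c : Fin n, a < c → (c : ℕ) - a = d → R' a c → R a c := by
  induction d using Nat.strong_induction_on with
  | _ d ih =>
  intro a c hac hd h
  rcases hstep a c hac.ne with ⟨x, h1, -, rfl | ⟨h3, h4⟩⟩ | ⟨x, h1, -, rfl | ⟨h3, h4⟩⟩
  · exact h1
  · have hx : a < x ∧ x < c := by unfold Between at h3; omega
    exact htrans _ _ _ h1 (ih _ (by omega) x c hx.2 rfl ((hR' _ _ _ h3 h).2.1 h4))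
  · exact absurd h1 (hdisj _ _ hac h)
  · have hx : a < x ∧ x < c := by unfold Between at h3; omega
    exact absurd h1 (hdisj _ _ hx.1 ((hR' _ _ _ h3 h).1 h4))

end

theorem exists_equiv_fin_monotone {β : Type*} [Fintype β] {n : ℕ} (hn : Fintype.card β = n)
    {R : β → β → Prop} (hrefl : ∀ a, R a a) (hantisymm : ∀ a b, R a b → R b a → a = b)
    (htrans : ∀ a b c, R a b → R b c → R a c) :
    ∃ e : Fin n ≃ β, ∀ u v, R u v → e.symm u ≤ e.symm v := by
  let _ : PartialOrder β :=
    { le := R, le_refl := hrefl, le_trans := htrans, le_antisymm := hantisymm }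
  let _ : Fintype (LinearExtension β) := ‹Fintype β›
  let e : Fin n ≃o LinearExtension β := Fintype.orderIsoFinOfCardEq (LinearExtension β) hn
  exact ⟨e.toEquiv, fun u v h => e.symm.monotone (toLinearExtension.monotone (show u ≤ v from h))⟩

/-! ### Interval posets -/

namespace Permutree
variable {n : ℕ} {δ : PermutreeOrientation n}

theorem rel_of_latticeLE {T T' : Permutree δ} (h : T.latticeLE T') {a c : Fin n} (hac : a < c)
    (h' : T'.rel a c) : T.rel a c := by
  obtain ⟨σ, τ, hσ, hτ, hle⟩ := h
  refine rel_of_step (R := T.rel) (fun _ _ _ => T.rel_trans) (fun _ _ => T.upStep_or_downStep)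
    T'.betweenConditions (fun a c hac h1 h2 => ?_) _ a c hac rfl h'
  -- If `T` puts `c` below `a`, this is an inversion of `σ`, hence of `τ`, while `T'` puts `a`
  -- before `c`.
  have : (c, a) ∈ permInversions τ := hle ⟨hac.le, hσ _ _ h2⟩
  exact hac.ne (τ.symm.injective (le_antisymm (hτ _ _ h1) this.2))

theorem rel_of_latticeLE' {T T' : Permutree δ} (h : T.latticeLE T') {a c : Fin n} (hac : a < c)
    (h' : T.rel c a) : T'.rel c a := by
  obtain ⟨σ, τ, hσ, hτ, hle⟩ := h
  refine rel_of_step (R := fun a b => T'.rel b a) (R' := fun a b => T.rel b a)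
    (fun _ _ _ h h' => T'.rel_trans h' h) (fun _ _ h => (T'.upStep_or_downStep h).symm)
    T.betweenConditions.flip (fun a c hac h1 h2 => ?_) _ a c hac rfl h'
  have : (c, a) ∈ permInversions τ := hle ⟨hac.le, hσ _ _ h1⟩
  exact hac.ne (τ.symm.injective (le_antisymm (hτ _ _ h2) this.2))

/-- Reflexivity needs a linear extension, which the hypothesis supplies. -/
theorem latticeLE_refl_left {T T' : Permutree δ} (h : T.latticeLE T') : T.latticeLE T := by
  obtain ⟨σ, -, hσ, -, -⟩ := h
  exact ⟨σ, σ, hσ, hσ, subset_rfl⟩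

theorem latticeLE_refl_right {T T' : Permutree δ} (h : T.latticeLE T') : T'.latticeLE T' := by
  obtain ⟨-, τ, -, hτ, -⟩ := h
  exact ⟨τ, τ, hτ, hτ, subset_rfl⟩

theorem intervalRel_iff_of_lt {T T' : Permutree δ} (h : T.latticeLE T') {a c : Fin n}
    (hac : a < c) : permutreeIntervalRel T T' a c ↔ T'.rel a c :=
  ⟨fun H => H T' h (latticeLE_refl_right h), fun H _ _ hS => rel_of_latticeLE hS hac H⟩

theorem intervalRel_iff_of_gt {T T' : Permutree δ} (h : T.latticeLE T') {a c : Fin n}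
    (hac : a < c) : permutreeIntervalRel T T' c a ↔ T.rel c a :=
  ⟨fun H => H T (latticeLE_refl_left h) h, fun H _ hS _ => rel_of_latticeLE' hS hac H⟩

end Permutree

theorem betweenConditions_of_mem_PIP {n : ℕ} {δ : PermutreeOrientation n}
    {R : Fin n → Fin n → Prop} (h : R ∈ PIP δ) : BetweenConditions δ.plus δ.minus R := by
  obtain ⟨T, T', hle, rfl⟩ := h
  rintro a b c (⟨hab, hbc⟩ | ⟨hab, hbc⟩) hR
  · rw [Permutree.intervalRel_iff_of_lt hle (hab.trans hbc)] at hR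
    rw [Permutree.intervalRel_iff_of_lt hle hab, Permutree.intervalRel_iff_of_lt hle hbc]
    exact T'.betweenConditions _ _ _ (.inl ⟨hab, hbc⟩) hR
  · rw [Permutree.intervalRel_iff_of_gt hle (hab.trans hbc)] at hR
    rw [Permutree.intervalRel_iff_of_gt hle hab, Permutree.intervalRel_iff_of_gt hle hbc]
    exact T.betweenConditions _ _ _ (.inr ⟨hab, hbc⟩) hR

theorem mem_PIP_of_mem_PEP {n : ℕ} {δ : PermutreeOrientation n} {R : Fin n → Fin n → Prop}
    (hrefl : ∀ a, R a a) (hantisymm : ∀ a b, R a b → R b a → a = b)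
    (htrans : ∀ a b c, R a b → R b c → R a c) (h : R ∈ PEP δ) : R ∈ PIP δ := by
  obtain ⟨T, rfl⟩ := h
  obtain ⟨σ, hσ⟩ := exists_equiv_fin_monotone (Fintype.card_fin n) hrefl hantisymm htrans
  have hle : T.latticeLE T := ⟨σ, σ, hσ, hσ, subset_rfl⟩
  refine ⟨T, T, hle, ?_⟩
  funext a c
  apply propext
  rcases lt_trichotomy a c with hac | rfl | hac
  · exact (Permutree.intervalRel_iff_of_lt hle hac).symm
  · exact iff_of_true .refl fun _ _ _ => .refl
  · exact (Permutree.intervalRel_iff_of_gt hle hac).symm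

theorem mainTheorem7 (n : ℕ) (hn : 1 ≤ n) (δ : PermutreeOrientation n)
    (R : Fin n → Fin n → Prop) (hrefl : ∀ a, R a a)
    (hantisymm : ∀ a b, R a b → R b a → a = b)
    (htrans : ∀ a b c, R a b → R b c → R a c) :
    (R ∈ PEP δ ↔ R ∈ PIP δ ∧ HasAllSnakes δ R) ∧
    (R ∈ PEP δ ↔ (WOIPConditions R ∧ OrientationConditions δ R) ∧ HasAllSnakes δ R) := by
  have hsnake : R ∈ PEP δ → HasAllSnakes δ R := by
    rintro ⟨T, rfl⟩
    exact hasAllSnakes_of_step htrans fun _ _ => T.upStep_or_downStep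
  have hmem : BetweenConditions δ.plus δ.minus R → HasAllSnakes δ R → R ∈ PEP δ := fun h h' =>
    SnakePoset.mem_PEP hn ⟨hrefl, hantisymm, htrans, h, step_of_hasAllSnakes h'⟩
  rw [← betweenConditions_iff]
  refine ⟨⟨fun h => ⟨mem_PIP_of_mem_PEP hrefl hantisymm htrans h, hsnake h⟩,
    fun h => hmem (betweenConditions_of_mem_PIP h.1) h.2⟩, ⟨fun h => ⟨?_, hsnake h⟩,
    fun h => hmem h.1 h.2⟩⟩
  obtain ⟨T, rfl⟩ := h
  exact T.betweenConditions
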